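/- For $\lambda=(\lambda_4,\lambda_6)\in\mathcal B_1=\{\lambda\in\mathbb C^2 : 4\lambda_4^3+27\lambda_6^2\neq 0\}$ let $V_\lambda=\{(x,y)\in\mathbb C^2 : y^2=x^3+\lambda_4x+\lambda_6\}$, and let $\Gamma(\lambda)\subset\mathbb C$ be the lattice generated by the periods $\oint \frac{dx}{2y}$ of the holomorphic differential along closed paths on $V_\lambda$. Let $\pi\colon\mathcal U_1\to\mathcal B_1\subset\mathbb C^2$ be the universal bundle with fibre $\mathbb C/\Gamma(\lambda)$ over $\lambda$. Let $\sigma(u;\lambda)=u\prod_{\omega\in\Gamma(\lambda)\setminus\{0\}}\bigl(1-\tfrac u\omega\bigr)e^{u/\omega+u^2/(2\omega^2)}$ be the Weierstrass sigma function of $\Gamma(\lambda)$ and, with $\partial=\partial/\partial u$, put $\wp_i(u;\lambda)=-\partial^i\ln\sigma(u;\lambda)$ for $i\ge 2$, so that $\wp_2=\wp$, $\wp_3=\wp'$, $\wp_4=\wp''$. Let $\mathcal P_1$ be the $\mathbb C$-algebra generated by all $\wp_i$, $i\ge2$, regarded as functions of $(\lambda,u)$ with $\lambda\in\mathcal B_1$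 and $u\in\mathbb C\setminus\Gamma(\lambda)$. **Theorem.** 1. $\mathcal P_1$ is the polynomial ring $\mathbb C[\wp,\wp',\wp'']$: there is an isomorphism of $\mathbb C$-algebras $\mathbb C[x_2,x_3,x_4]\to\mathcal P_1$ with $x_2\mapsto\wp$, $x_3\mapsto\wp'$, $x_4\mapsto\wp''$. 2. The projection $\pi\colon\mathcal U_1\to\mathbb C^2$ is given by polynomials in $\wp,\wp',\wp''$: for every $\lambda\in\mathcal B_1$ and every $u\in\mathbb C\setminus\Gamma(\lambda)$, the point $(\lambda, u \bmod \Gamma(\lambda))$ of $\mathcal U_1$ is mapped by $\pi$ to $(\lambda_4,\lambda_6)$ with $$\lambda_4=\tfrac12\wp''-3\wp^2,\qquad \lambda_6=\Bigl(\frac{\wp'}2\Bigr)^2+2\wp^3-\tfrac12\wp''\wp,$$ where $\wp,\wp',\wp''$ are evaluated at $(u;\lambda)$. -/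

import Mathlib

noncomputable section

namespace GenusOne

/-- The base `B₁ = ℂ² ∖ Δ`: the parameters `l = (λ₄, λ₆)` for which the cubic
`x³ + λ₄ x + λ₆` has no multiple root. -/
def baseSpace : Set (ℂ × ℂ) := {l | 4 * l.1 ^ 3 + 27 * l.2 ^ 2 ≠ 0}

/-- A closed `C¹` path `t ↦ (x t, y t)`, `t ∈ [0, 1]`, on the affine curve
`V_λ : y² = x³ + λ₄ x + λ₆`. The function `w` is the value of the holomorphic differential
`du = dx / (2 y) = dy / (3 x² + λ₄)` on the velocity vector of the path; the two equations
`dx = 2 y du` and `dy = (3 x² + λ₄) du` also determine it where `y = 0`. -/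
structure CurveLoop (l : ℂ × ℂ) where
  x : ℝ → ℂ
  y : ℝ → ℂ
  w : ℝ → ℂ
  mem_curve : ∀ t ∈ Set.Icc (0 : ℝ) 1, y t ^ 2 = x t ^ 3 + l.1 * x t + l.2
  continuousOn_w : ContinuousOn w (Set.Icc 0 1)
  hasDeriv_x : ∀ t ∈ Set.Icc (0 : ℝ) 1,
    HasDerivWithinAt x (2 * y t * w t) (Set.Icc 0 1) t
  hasDeriv_y : ∀ t ∈ Set.Icc (0 : ℝ) 1,
    HasDerivWithinAt y ((3 * x t ^ 2 + l.1) * w t) (Set.Icc 0 1) t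
  x_closed : x 0 = x 1
  y_closed : y 0 = y 1

/-- The period `∮ dx / (2 y)` of the holomorphic differential along a closed path. -/
def CurveLoop.period {l : ℂ × ℂ} (c : CurveLoop l) : ℂ := ∫ t in (0 : ℝ)..1, c.w t

/-- `Γ₁(λ) ⊂ ℂ`, the group generated by the periods of `dx / (2 y)` on cycles of `V_λ`. -/
def periodLattice (l : ℂ × ℂ) : AddSubgroup ℂ :=
  AddSubgroup.closure (Set.range fun c : CurveLoop l => c.period)

/-- The space `U₁` of the universal bundle, with fibre `Jac(V_λ) = ℂ / Γ₁(λ)` over `λ ∈ B₁`. -/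
def UniversalSpace : Type := Σ l : baseSpace, ℂ ⧸ periodLattice l

/-- The projection `π : U₁ → B₁ ⊂ ℂ²`. -/
def proj (p : UniversalSpace) : ℂ × ℂ := p.1

/-- The map `φ : B₁ × ℂ → U₁` given by `{λ} × ℂ → ℂ / Γ₁(λ)`. -/
def toUniversal (l : baseSpace) (u : ℂ) : UniversalSpace := ⟨l, (u : ℂ ⧸ periodLattice l)⟩

/-- The Weierstrass sigma function
`σ(u; λ) = u ∏ (1 - u / ω) exp (u / ω + u² / (2 ω²))`, the product over `ω ∈ Γ₁(λ) ∖ {0}`. -/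
def sigma (l : ℂ × ℂ) (u : ℂ) : ℂ :=
  u * ∏' ω : {ω : periodLattice l // ω ≠ 0},
    (1 - u / (ω.1 : ℂ)) * Complex.exp (u / (ω.1 : ℂ) + u ^ 2 / (2 * (ω.1 : ℂ) ^ 2))

/-- `ζ(u; λ) = ∂ ln σ(u; λ)`, where `∂ = ∂ / ∂u`. -/
def zeta (l : ℂ × ℂ) (u : ℂ) : ℂ := logDeriv (sigma l) u

/-- `℘_i(u; λ) = - ∂^i ln σ(u; λ) = - ∂^(i-1) ζ(u; λ)`, used for `i ≥ 2` only. -/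
def wp (i : ℕ) (l : ℂ × ℂ) (u : ℂ) : ℂ := - iteratedDeriv (i - 1) (zeta l) u

/-- The points `(λ, u)` of `B₁ × ℂ` with `u ∉ Γ₁(λ)`: the complement of the poles of the `℘_i`. -/
def regularDomain : Set ((ℂ × ℂ) × ℂ) := {q | q.1 ∈ baseSpace ∧ q.2 ∉ periodLattice q.1}

/-- `℘_i` as a function of `λ` and `u`. -/
def wpFun (i : ℕ) : regularDomain → ℂ := fun q => wp i q.1.1 q.1.2

/-- The ring `P₁` generated over `ℂ` by the functions `℘_i`, `i ≥ 2`, of `(λ, u)`. -/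
def ringP : Subalgebra ℂ (regularDomain → ℂ) :=
  Algebra.adjoin ℂ {f | ∃ i : ℕ, 2 ≤ i ∧ f = wpFun i}

end GenusOne

end

/-! Uniformization reduces everything to classical facts about one lattice `L`. Every λ with nonzero
discriminant is (-g₂/4, -g₃/4) for some `L` (`exists_g₂_eq_g₃_eq`), because a weight 12 form nonzero
at the cusp has a zero in the upper half plane. The map u ↦ (℘, ℘'/2) is onto the affine curve, is
injective modulo `L`, and pulls dx/(2y) back to du. Lifting loops along it shows that the periods
generate exactly `L.lattice` (`mem_periodLattice_iff`). Logarithmic differentiation of σ then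
identifies the ℘_i with ℘ and its derivatives.

Part 2 is ℘'' = 6℘² - g₂/2 combined with ℘'² = 4℘³ - g₂℘ - g₃. For part 1, ℘''' = 12℘℘' no longer
involves λ, so each ℘_i is a polynomial in ℘, ℘', ℘'' with coefficients independent of λ
(`wpFun_add_two`). These three are algebraically independent because they jointly take every value
in ℂ³ off the discriminant hypersurface (`exists_wpFun_eq`). -/

section

open Filter Topology

/-! ### Zeros of level one modular forms of weight 12. -/

open UpperHalfPlane ModularForm MatrixGroups in
lemma ModularForm.tendsto_valueAtInfty {k : ℤ} (g : ModularForm 𝒮ℒ k) :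
    Tendsto g atImInfty (𝓝 (valueAtInfty g)) := by
  obtain ⟨c, hc, hO⟩ := ModularFormClass.exp_decay_sub_atImInfty' g
  have : Tendsto (fun τ : ℍ ↦ Real.exp (-c * τ.im)) atImInfty (𝓝 0) :=
    Real.tendsto_exp_atBot.comp (tendsto_comap.const_mul_atTop_of_neg (by linarith))
  simpa [sub_eq_zero] using (hO.trans_tendsto this).add_const (valueAtInfty g)

open UpperHalfPlane ModularForm MatrixGroups EisensteinSeries in
lemma ModularForm.tendsto_E_atImInfty {k : ℕ} (hk : 3 ≤ k) (hk2 : Even k) :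
    Tendsto (E hk) atImInfty (𝓝 1) := by
  rw [← E_qExpansion_coeff_zero hk hk2,
    qExpansion_coeff_zero one_pos
      (ModularFormClass.analyticAt_cuspFunction_zero _ one_pos one_mem_strictPeriods_SL)
      (SlashInvariantFormClass.periodic_comp_ofComplex _ one_mem_strictPeriods_SL)]
  exact tendsto_valueAtInfty _

open UpperHalfPlane ModularForm MatrixGroups EisensteinSeries in
/-- A level one modular form of weight `12` which does not vanish at the cusp has a zero. -/
lemma ModularForm.exists_eq_zero_of_weight_twelve (f : ModularForm 𝒮ℒ 12)
    (hf : valueAtInfty f ≠ 0) : ∃ τ : ℍ, f τ = 0 := by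
  by_contra! h0
  -- Without zeros of `f`, the quotient E₄/f is holomorphic of weight -8, and bounded at the cusps
  -- since `f` has a nonzero limit there. Negative weight forces it to vanish, but E₄ ≠ 0.
  have hslash (γ : SL(2, ℤ)) : (⇑E₄ / ⇑f) ∣[(4 - 12 : ℤ)] γ = ⇑E₄ / ⇑f := by
    have hγ : (γ : GL (Fin 2) ℝ) ∈ 𝒮ℒ := ⟨γ, rfl⟩
    simp_rw [div_slash_SL2, SL_slash]
    rw [SlashInvariantForm.slash_action_eqn E₄ _ hγ, SlashInvariantForm.slash_action_eqn f _ hγ]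
  let q : ModularForm 𝒮ℒ (4 - 12) :=
    { toFun := ⇑E₄ / ⇑f
      slash_action_eq' := fun _ ⟨γ, hγ⟩ ↦ hγ ▸ hslash γ
      holo' := E₄.holo'.div f.holo' h0
      bdd_at_cusps' {c} hc := by
        rw [Subgroup.IsArithmetic.isCusp_iff_isCusp_SL2Z] at hc
        rw [OnePoint.isBoundedAt_iff_forall_SL2Z hc]
        intro γ _
        rw [hslash γ, IsBoundedAtImInfty, BoundedAtFilter]
        exact ((tendsto_valueAtInfty E₄).div (tendsto_valueAtInfty f) hf).isBigO_one ℝ }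
  have hq : ⇑q = 0 := ModularFormClass.levelOne_neg_weight_eq_zero (by norm_num) q
  refine E_ne_zero (k := 4) (by norm_num) ⟨2, rfl⟩ (DFunLike.coe_injective ?_)
  funext z
  have : E₄ z / f z = 0 := congrFun hq z
  simpa [h0 z] using this

-- E₄ and E₆ both tend to 1 at the cusp, so aE₄³ - bE₆² has the nonzero limit a - b there.
open UpperHalfPlane ModularForm MatrixGroups EisensteinSeries in
lemma ModularForm.exists_mul_E₄_cube_eq_mul_E₆_sq {a b : ℂ} (h : a ≠ b) :
    ∃ τ : ℍ, a * E₄ τ ^ 3 = b * E₆ τ ^ 2 := by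
  let f : ModularForm 𝒮ℒ 12 := a • ModularForm.mcast (by decide) (E₄.pow 3) -
    b • ModularForm.mcast (by decide) (E₆.pow 2)
  have hfz (z : ℍ) : f z = a * E₄ z ^ 3 - b * E₆ z ^ 2 := by
    change a * (E₄.pow 3) z - b * (E₆.pow 2) z = _
    rw [coe_pow, coe_pow, Pi.pow_apply, Pi.pow_apply]
  have hlim : Tendsto f atImInfty (𝓝 (a - b)) := by
    have := (((tendsto_E_atImInfty (k := 4) (by norm_num) ⟨2, rfl⟩).pow 3).const_mul a).sub
      (((tendsto_E_atImInfty (k := 6) (by norm_num) ⟨3, rfl⟩).pow 2).const_mul b)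
    simp only [one_pow, mul_one] at this
    exact this.congr fun z ↦ (hfz z).symm
  obtain ⟨τ, hτ⟩ := exists_eq_zero_of_weight_twelve f (by
    rw [tendsto_nhds_unique (tendsto_valueAtInfty f) hlim]
    exact sub_ne_zero.mpr h)
  exact ⟨τ, by linear_combination hτ - hfz τ⟩

/-! ### Lattices with prescribed invariants. -/

namespace PeriodPair

/-- The lattice `t⁻¹ (ℤ τ + ℤ)`. -/
noncomputable def ofUpperHalfPlane (τ : UpperHalfPlane) {t : ℂ} (ht : t ≠ 0) : PeriodPair where
  ω₁ := t⁻¹ * τ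
  ω₂ := t⁻¹
  indep := by
    rw [LinearIndependent.pair_iff]
    intro a b h
    have h1 : (a : ℂ) * τ + b = 0 := by
      have : t⁻¹ * ((a : ℂ) * τ + b) = 0 := by
        simp only [Complex.real_smul] at h
        linear_combination h
      simpa [ht] using this
    have ha : a = 0 := by
      have := congrArg Complex.im h1
      simpa [τ.im_ne_zero] using this
    subst ha
    simpa using h1

lemma G_ofUpperHalfPlane (τ : UpperHalfPlane) {t : ℂ} (ht : t ≠ 0) {k : ℕ} (hk : 3 ≤ k) :
    (ofUpperHalfPlane τ ht).G k = 2 * riemannZeta k * t ^ k * ModularForm.E hk τ := by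
  have hE : eisensteinSeries (N := 1) 0 k τ = 2 * ModularForm.E hk τ := by
    change _ = 2 * ((1 / 2 : ℂ) * eisensteinSeries (N := 1) 0 k τ)
    ring
  have h := _root_.tsum_eisSummand_eq_riemannZeta_mul_eisensteinSeries hk τ
  rw [hE, ← (finTwoArrowEquiv ℤ).symm.tsum_eq] at h
  rw [G, ← (ofUpperHalfPlane τ ht).latticeEquivProd.symm.toEquiv.tsum_eq]
  rw [show 2 * riemannZeta k * t ^ k * ModularForm.E hk τ =
    t ^ k * (riemannZeta k * (2 * ModularForm.E hk τ)) by ring, ← h, ← tsum_mul_left]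
  refine tsum_congr fun x ↦ ?_
  have : (((ofUpperHalfPlane τ ht).latticeEquivProd.symm.toEquiv x : _) : ℂ) =
      t⁻¹ * (x.1 * τ + x.2) := by
    refine ((ofUpperHalfPlane τ ht).latticeEquiv_symm_apply x).trans ?_
    simp only [ofUpperHalfPlane]
    ring
  rw [this]
  simp [EisensteinSeries.eisSummand, mul_pow, mul_comm]

lemma _root_.riemannZeta_six : riemannZeta 6 = (Real.pi : ℂ) ^ 6 / 945 := by
  have h := riemannZeta_two_mul_nat (k := 3) (by norm_num)
  norm_num [show bernoulli 6 = 1 / 42 by decide +kernel, Nat.factorial] at h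
  rw [h]
  ring

/-- Every pair of complex numbers with nonzero discriminant is the pair of invariants of a
lattice. -/
theorem exists_g₂_eq_g₃_eq {a b : ℂ} (h : a ^ 3 ≠ 27 * b ^ 2) :
    ∃ L : PeriodPair, L.g₂ = a ∧ L.g₃ = b := by
  have hpi : (Real.pi : ℂ) ≠ 0 := by exact_mod_cast Real.pi_ne_zero
  -- For t⁻¹(ℤτ + ℤ), g₂ = (4π⁴/3) t⁴E₄(τ) and g₃ = (8π⁶/27) t⁶E₆(τ). So `A` and `B` are the
  -- required values of t⁴E₄ and t⁶E₆; τ fixes the ratio of E₄³ to E₆², and t the scale.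
  set A : ℂ := 3 * a / (4 * Real.pi ^ 4) with hA
  set B : ℂ := 27 * b / (8 * Real.pi ^ 6) with hB
  have hAB : B ^ 2 ≠ A ^ 3 := by
    intro e
    apply h
    rw [hA, hB] at e
    field_simp at e
    linear_combination -e / 1728
  obtain ⟨τ, hτ⟩ := ModularForm.exists_mul_E₄_cube_eq_mul_E₆_sq hAB
  have hΔ : ModularForm.E₄ τ ^ 3 - ModularForm.E₆ τ ^ 2 ≠ 0 := by
    have h1 := ModularForm.discriminant_ne_zero τ
    rw [ModularForm.discriminant_eq_E₄_cube_sub_E₆_sq] at h1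
    exact fun e ↦ h1 (by rw [e]; simp)
  set p := ModularForm.E₄ τ with hp
  set q := ModularForm.E₆ τ with hq
  suffices ∃ t : ℂ, t ≠ 0 ∧ t ^ 4 * p = A ∧ t ^ 6 * q = B by
    obtain ⟨t, ht, h4, h6⟩ := this
    refine ⟨ofUpperHalfPlane τ ht, ?_, ?_⟩
    · have := G_ofUpperHalfPlane τ ht (k := 4) (by norm_num)
      rw [g₂, this]
      push_cast
      rw [riemannZeta_four, ← hp]
      rw [hA] at h4
      field_simp at h4
      linear_combination h4 / 3
    · have := G_ofUpperHalfPlane τ ht (k := 6) (by norm_num)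
      rw [g₃, this]
      push_cast
      rw [riemannZeta_six, ← hq]
      rw [hB] at h6
      field_simp at h6
      linear_combination h6 / 27
  -- If E₄ or E₆ vanishes at τ, the other does not, and only one equation for t remains.
  by_cases hp0 : p = 0
  · have hq0 : q ≠ 0 := fun e ↦ hΔ (by simp [hp0, e])
    have hA0 : A = 0 := by simpa [hp0, hq0] using hτ
    have hB0 : B ≠ 0 := fun e ↦ hAB (by simp [hA0, e])
    obtain ⟨t, ht⟩ := IsAlgClosed.exists_pow_nat_eq (B / q) (n := 6) (by norm_num)
    refine ⟨t, ?_, by simp [hp0, hA0], by rw [ht]; field_simp⟩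
    rintro rfl
    exact div_ne_zero hB0 hq0 (by simpa using ht.symm)
  by_cases hq0 : q = 0
  · have hB0 : B = 0 := by simpa [hp0, hq0] using hτ
    have hA0 : A ≠ 0 := fun e ↦ hAB (by simp [hB0, e])
    obtain ⟨t, ht⟩ := IsAlgClosed.exists_pow_nat_eq (A / p) (n := 4) (by norm_num)
    refine ⟨t, ?_, by rw [ht]; field_simp, by simp [hq0, hB0]⟩
    rintro rfl
    exact div_ne_zero hA0 hp0 (by simpa using ht.symm)
  have hA0 : A ≠ 0 := fun e ↦ hAB (by
    have : B = 0 := by simpa [e, hp0] using hτ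
    simp [e, this])
  have hB0 : B ≠ 0 := fun e ↦ hA0 (by simpa [e, hq0] using hτ.symm)
  -- t² is forced, as the quotient of t⁶ = B/q by t⁴ = A/p.
  obtain ⟨t, ht⟩ := IsAlgClosed.exists_pow_nat_eq (B * p / (q * A)) (n := 2) (by norm_num)
  have ht0 : t ≠ 0 := by
    rintro rfl
    exact div_ne_zero (mul_ne_zero hB0 hp0) (mul_ne_zero hq0 hA0) (by simpa using ht.symm)
  have h4 : t ^ 4 * p = A := by
    rw [show t ^ 4 = (t ^ 2) ^ 2 by ring, ht]
    field_simp
    linear_combination hτ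
  refine ⟨t, ht0, h4, ?_⟩
  have : t ^ 6 * q * p = B * p := by
    calc t ^ 6 * q * p = t ^ 2 * q * (t ^ 4 * p) := by ring
      _ = B * p := by rw [h4, ht]; field_simp
  exact mul_right_cancel₀ hp0 this

end PeriodPair

/-! ### The differential equation of the curve and its parametrization by ℘. -/

open Set Metric in
/-- Uniqueness of solutions of `x' = 2 y w`, `y' = (3 x² + m) w`. -/
lemma cubic_ode_unique {m : ℂ} {a b : ℝ} {w x₁ y₁ x₂ y₂ : ℝ → ℂ} (hw : ContinuousOn w (Icc a b))
    (hx₁ : ∀ t ∈ Icc a b, HasDerivWithinAt x₁ (2 * y₁ t * w t) (Icc a b) t)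
    (hy₁ : ∀ t ∈ Icc a b, HasDerivWithinAt y₁ ((3 * x₁ t ^ 2 + m) * w t) (Icc a b) t)
    (hx₂ : ∀ t ∈ Icc a b, HasDerivWithinAt x₂ (2 * y₂ t * w t) (Icc a b) t)
    (hy₂ : ∀ t ∈ Icc a b, HasDerivWithinAt y₂ ((3 * x₂ t ^ 2 + m) * w t) (Icc a b) t)
    (hx : x₁ a = x₂ a) (hy : y₁ a = y₂ a) {t : ℝ} (ht : t ∈ Icc a b) :
    x₁ t = x₂ t ∧ y₁ t = y₂ t := by
  let P : ℂ × ℂ → ℂ × ℂ := fun p ↦ (2 * p.2, 3 * p.1 ^ 2 + m)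
  let v : ℝ → ℂ × ℂ → ℂ × ℂ := fun t p ↦ w t • P p
  have hd {x y : ℝ → ℂ} (h₁ : ∀ t ∈ Icc a b, HasDerivWithinAt x (2 * y t * w t) (Icc a b) t)
      (h₂ : ∀ t ∈ Icc a b, HasDerivWithinAt y ((3 * x t ^ 2 + m) * w t) (Icc a b) t) :
      ∀ t ∈ Icc a b, HasDerivWithinAt (fun s ↦ (x s, y s)) (v t (x t, y t)) (Icc a b) t := by
    intro t ht
    convert! (h₁ t ht).prodMk (h₂ t ht) using 1
    ext <;> simp [v, P, mul_comm]
  have hd' {f : ℝ → ℂ × ℂ} (h : ∀ t ∈ Icc a b, HasDerivWithinAt f (v t (f t)) (Icc a b) t) :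
      ∀ t ∈ Ico a b, HasDerivWithinAt f (v t (f t)) (Ici t) t := fun t ht ↦
    (h t ⟨ht.1, ht.2.le⟩).mono_of_mem_nhdsWithin (Icc_mem_nhdsGE_of_mem ht)
  have h₁ := hd hx₁ hy₁
  have h₂ := hd hx₂ hy₂
  have hc₁ : ContinuousOn (fun s ↦ (x₁ s, y₁ s)) (Icc a b) :=
    fun t ht ↦ (h₁ t ht).continuousWithinAt
  have hc₂ : ContinuousOn (fun s ↦ (x₂ s, y₂ s)) (Icc a b) :=
    fun t ht ↦ (h₂ t ht).continuousWithinAt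
  -- `P` is only locally Lipschitz, but both solutions stay in a ball over the compact interval.
  obtain ⟨R₁, hR₁⟩ := isCompact_Icc.exists_bound_of_continuousOn hc₁
  obtain ⟨R₂, hR₂⟩ := isCompact_Icc.exists_bound_of_continuousOn hc₂
  obtain ⟨C, hC⟩ := isCompact_Icc.exists_bound_of_continuousOn hw
  obtain ⟨K, hK⟩ : ∃ K, LipschitzOnWith K P (closedBall 0 (max R₁ R₂)) := by
    refine ContDiffOn.exists_lipschitzOnWith (n := 1) ?_ (by norm_num)
      (convex_closedBall _ _) (isCompact_closedBall _ _)
    fun_prop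
  have hv : ∀ t ∈ Ico a b, LipschitzOnWith (C.toNNReal * K) (v t) (closedBall 0 (max R₁ R₂)) := by
    intro t ht
    refine LipschitzOnWith.of_dist_le_mul fun p hp q hq ↦ ?_
    have hwt := hC t ⟨ht.1, ht.2.le⟩
    have hC0 : 0 ≤ C := (norm_nonneg _).trans hwt
    have := hK.dist_le_mul p hp q hq
    simp only [v, dist_smul₀, NNReal.coe_mul, Real.coe_toNNReal _ hC0, mul_assoc]
    gcongr
  have := ODE_solution_unique_of_mem_Icc_right (s := fun _ ↦ closedBall 0 (max R₁ R₂)) hv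
    hc₁ (hd' h₁) (fun t ht ↦ by simpa using Or.inl (hR₁ t ⟨ht.1, ht.2.le⟩))
    hc₂ (hd' h₂) (fun t ht ↦ by simpa using Or.inr (hR₂ t ⟨ht.1, ht.2.le⟩))
    (by simp [hx, hy]) ht
  simpa using this

namespace PeriodPair

variable (L : PeriodPair)

lemma lattice_countable : (L.lattice : Set ℂ).Countable :=
  countable_of_Lindelof_of_discrete (X := L.lattice)

lemma isPreconnected_compl_lattice : IsPreconnected ((L.lattice : Set ℂ)ᶜ) :=
  (L.lattice_countable.isConnected_compl_of_one_lt_rank (by simp)).isPreconnected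

lemma isOpen_compl_lattice : IsOpen ((L.lattice : Set ℂ)ᶜ) := L.isClosed_lattice.isOpen_compl

lemma tendsto_weierstrassP_cobounded {x : ℂ} (hx : x ∈ L.lattice) :
    Tendsto L.weierstrassP (𝓝[≠] x) (Bornology.cobounded ℂ) :=
  tendsto_cobounded_of_meromorphicOrderAt_neg (by rw [L.order_weierstrassP x hx]; decide)

lemma hasDerivAt_weierstrassP {z : ℂ} (hz : z ∉ L.lattice) :
    HasDerivAt L.weierstrassP (L.derivWeierstrassP z) z := by
  rw [← L.deriv_weierstrassP]
  exact (L.analyticOnNhd_weierstrassP z hz).differentiableAt.hasDerivAt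

lemma eventually_notMem_lattice (x : ℂ) : ∀ᶠ z in 𝓝[≠] x, z ∉ L.lattice := by
  filter_upwards [nhdsWithin_le_nhds (L.compl_lattice_sdiff_singleton_mem_nhds x),
    self_mem_nhdsWithin] with z hz hzx
  exact fun h ↦ hz ⟨h, hzx⟩

lemma exists_derivWeierstrassP_ne_zero : ∃ z ∉ L.lattice, L.derivWeierstrassP z ≠ 0 := by
  by_contra! h
  obtain ⟨c, hc⟩ := L.isOpen_compl_lattice.exists_is_const_of_deriv_eq_zero
    L.isPreconnected_compl_lattice L.differentiableOn_weierstrassP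
    (fun z hz ↦ by rw [L.deriv_weierstrassP]; exact h z hz)
  have h0 := L.tendsto_weierstrassP_cobounded (zero_mem _)
  have h1 : Tendsto L.weierstrassP (𝓝[≠] 0) (𝓝 c) :=
    tendsto_const_nhds.congr' <| by
      filter_upwards [L.eventually_notMem_lattice 0] with z hz using (hc z hz).symm
  exact h1.not_tendsto (Metric.disjoint_nhds_cobounded c) h0

/-- `℘'' = 6 ℘² - g₂ / 2`. -/
lemma deriv_derivWeierstrassP {z : ℂ} (hz : z ∉ L.lattice) :
    deriv L.derivWeierstrassP z = 6 * L.weierstrassP z ^ 2 - L.g₂ / 2 := by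
  have han := L.analyticOnNhd_weierstrassP
  have han' := L.analyticOnNhd_derivWeierstrassP
  -- Differentiating the cubic relation gives the claim multiplied by ℘'. The factor ℘' cancels by
  -- the identity theorem, as the complement of the lattice is connected.
  have key : ∀ z ∈ (L.lattice : Set ℂ)ᶜ, L.derivWeierstrassP z *
      (deriv L.derivWeierstrassP z - (6 * L.weierstrassP z ^ 2 - L.g₂ / 2)) = 0 := by
    intro z hz
    have h1 := L.hasDerivAt_weierstrassP hz
    have h2 := (han' z hz).differentiableAt.hasDerivAt
    have e : (fun z ↦ L.derivWeierstrassP z ^ 2) =ᶠ[𝓝 z]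
        fun z ↦ 4 * L.weierstrassP z ^ 3 - L.g₂ * L.weierstrassP z - L.g₃ := by
      filter_upwards [L.isOpen_compl_lattice.mem_nhds hz] with y hy
        using L.derivWeierstrassP_sq y hy
    have := ((h2.fun_pow 2).congr_of_eventuallyEq e.symm).unique
      ((((h1.fun_pow 3).const_mul 4).sub (h1.const_mul L.g₂)).sub_const L.g₃)
    simp only [Nat.cast_ofNat, Nat.add_one_sub_one, pow_one] at this
    linear_combination this / 2
  rcases han'.eq_zero_or_eq_zero_of_mul_eq_zero
    (han'.deriv.sub (((analyticOnNhd_const (v := 6)).mul (han.pow 2)).sub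
      (analyticOnNhd_const (v := L.g₂ / 2)))) key L.isPreconnected_compl_lattice with h | h
  · obtain ⟨y, hy, hy'⟩ := L.exists_derivWeierstrassP_ne_zero
    exact absurd (h y hy) hy'
  · exact sub_eq_zero.mp (h z hz)

lemma hasDerivAt_derivWeierstrassP {z : ℂ} (hz : z ∉ L.lattice) :
    HasDerivAt L.derivWeierstrassP (6 * L.weierstrassP z ^ 2 - L.g₂ / 2) z := by
  rw [← L.deriv_derivWeierstrassP hz]
  exact (L.analyticOnNhd_derivWeierstrassP z hz).differentiableAt.hasDerivAt

/-- `℘` takes every complex value. -/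
lemma exists_weierstrassP_eq (c : ℂ) : ∃ z ∉ L.lattice, L.weierstrassP z = c := by
  classical
  by_contra! h
  -- If c is omitted, 1/(℘ - c), extended by 0 at the poles, is entire and periodic, hence constant
  -- by Liouville; yet it is 0 at 0 and nonzero at ω₁/2.
  let f : ℂ → ℂ := fun z ↦ if z ∈ L.lattice then 0 else (L.weierstrassP z - c)⁻¹
  have hd : ∀ z ∉ L.lattice, DifferentiableAt ℂ f z := by
    intro z hz
    have h1 : DifferentiableAt ℂ (fun z ↦ (L.weierstrassP z - c)⁻¹) z :=
      ((L.hasDerivAt_weierstrassP hz).differentiableAt.sub_const c).inv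
        (sub_ne_zero.mpr (h z hz))
    refine h1.congr_of_eventuallyEq ?_
    filter_upwards [L.isOpen_compl_lattice.mem_nhds hz] with y hy
    exact if_neg hy
  have hf : Differentiable ℂ f := by
    intro z
    by_cases hz : z ∈ L.lattice
    · refine (Complex.analyticAt_of_differentiable_on_punctured_nhds_of_continuousAt
        ?_ ?_).differentiableAt
      · filter_upwards [L.eventually_notMem_lattice z] with y hy using hd y hy
      · rw [continuousAt_iff_punctured_nhds, show f z = 0 from if_pos hz]
        have h2 : Tendsto (fun z ↦ (L.weierstrassP z - c)⁻¹) (𝓝[≠] z) (𝓝 0) :=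
          tendsto_inv₀_cobounded.comp
            ((tendsto_sub_const_cobounded c).comp (L.tendsto_weierstrassP_cobounded hz))
        refine h2.congr' ?_
        filter_upwards [L.eventually_notMem_lattice z] with y hy using (if_neg hy).symm
    · exact hd z hz
  have hper : ∀ z, ∀ w ∈ L.lattice, f (z + w) = f z := by
    intro z w hw
    have : z + w ∈ L.lattice ↔ z ∈ L.lattice := L.lattice.add_mem_iff_left hw
    simp only [f, this]
    lift w to L.lattice using hw
    rw [L.weierstrassP_add_coe]
  have hz := L.ω₁_div_two_notMem_lattice
  have := hf.apply_eq_apply_of_bounded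
    (IsZLattice.isCompact_range_of_periodic L.lattice f hf.continuous hper).isBounded
    (L.ω₁ / 2) 0
  rw [show f 0 = 0 from if_pos (zero_mem _), show f (L.ω₁ / 2) = _ from if_neg hz] at this
  exact inv_ne_zero (sub_ne_zero.mpr (h _ hz)) this

/-- The map `(℘, ℘')` is onto the affine curve. -/
lemma exists_weierstrassP_eq_derivWeierstrassP_eq {x y : ℂ}
    (h : y ^ 2 = 4 * x ^ 3 - L.g₂ * x - L.g₃) :
    ∃ z ∉ L.lattice, L.weierstrassP z = x ∧ L.derivWeierstrassP z = y := by
  obtain ⟨z, hz, rfl⟩ := L.exists_weierstrassP_eq x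
  rw [← L.derivWeierstrassP_sq z hz, sq_eq_sq_iff_eq_or_eq_neg] at h
  rcases h with h | h
  · exact ⟨z, hz, rfl, h.symm⟩
  · exact ⟨-z, by simpa using hz, by simp, by simp [h]⟩

/-- With the next lemma: (℘(u), ℘'(u)/2) satisfies the equations of `CurveLoop` with w = u' and λ₄ =
-g₂/4. -/
lemma hasDerivAt_weierstrassP_comp {u : ℝ → ℂ} {w : ℂ} {t : ℝ} (hu : HasDerivAt u w t)
    (ht : u t ∉ L.lattice) :
    HasDerivAt (fun s ↦ L.weierstrassP (u s)) (2 * (L.derivWeierstrassP (u t) / 2) * w) t := by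
  convert! (L.hasDerivAt_weierstrassP ht).comp t hu using 1
  ring

lemma hasDerivAt_derivWeierstrassP_comp {u : ℝ → ℂ} {w : ℂ} {t : ℝ} (hu : HasDerivAt u w t)
    (ht : u t ∉ L.lattice) :
    HasDerivAt (fun s ↦ L.derivWeierstrassP (u s) / 2)
      ((3 * L.weierstrassP (u t) ^ 2 + -L.g₂ / 4) * w) t := by
  convert! ((L.hasDerivAt_derivWeierstrassP ht).comp t hu).div_const 2 using 1
  ring

/-- The map `(℘, ℘')` is injective modulo the lattice. -/
lemma sub_mem_lattice_of_eq {a b : ℂ} (ha : a ∉ L.lattice) (hb : b ∉ L.lattice)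
    (h : L.weierstrassP a = L.weierstrassP b)
    (h' : L.derivWeierstrassP a = L.derivWeierstrassP b) : a - b ∈ L.lattice := by
  have hsmall (c : ℂ) (hc : c ∉ L.lattice) : ∀ᶠ s : ℝ in 𝓝 0, c + s ∉ L.lattice := by
    have : Tendsto (fun s : ℝ ↦ c + (s : ℂ)) (𝓝 0) (𝓝 c) := by
      have : Continuous fun s : ℝ ↦ c + (s : ℂ) := by fun_prop
      simpa using this.tendsto 0
    exact this.eventually (L.isOpen_compl_lattice.mem_nhds hc)
  obtain ⟨ε, hε, hball⟩ := Metric.eventually_nhds_iff_ball.mp ((hsmall a ha).and (hsmall b hb))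
  have hs : ∀ s ∈ Set.Icc (0 : ℝ) (ε / 2), s ∈ Metric.ball (0 : ℝ) ε := by
    intro s hs
    rw [Real.ball_eq_Ioo]
    constructor <;> linarith [hs.1, hs.2]
  -- The translates by a and b solve one differential equation with the same initial data, so they
  -- agree for small real s ≥ 0. The identity theorem extends this to the complement of their poles.
  have heq : ∀ s ∈ Set.Icc (0 : ℝ) (ε / 2), L.weierstrassP (a + s) = L.weierstrassP (b + s) := by
    intro s hs'
    have hu (c : ℂ) (t : ℝ) : HasDerivAt (fun s : ℝ ↦ c + (s : ℂ)) 1 t :=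
      (Complex.ofRealCLM.hasDerivAt (x := t)).const_add c
    exact (cubic_ode_unique (m := -L.g₂ / 4) (w := fun _ ↦ 1) continuousOn_const
      (fun t ht ↦ (L.hasDerivAt_weierstrassP_comp (hu a t) (hball t (hs t ht)).1).hasDerivWithinAt)
      (fun t ht ↦ (L.hasDerivAt_derivWeierstrassP_comp (hu a t)
        (hball t (hs t ht)).1).hasDerivWithinAt)
      (fun t ht ↦ (L.hasDerivAt_weierstrassP_comp (hu b t) (hball t (hs t ht)).2).hasDerivWithinAt)
      (fun t ht ↦ (L.hasDerivAt_derivWeierstrassP_comp (hu b t)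
        (hball t (hs t ht)).2).hasDerivWithinAt)
      (by simpa using h) (by simp [h']) hs').1
  set S : Set ℂ := (fun z ↦ a + z) ⁻¹' L.lattice ∪ (fun z ↦ b + z) ⁻¹' L.lattice with hS
  have hScount : S.Countable :=
    (L.lattice_countable.preimage (add_right_injective a)).union
      (L.lattice_countable.preimage (add_right_injective b))
  have han (c : ℂ) (hc : ∀ z ∈ Sᶜ, c + z ∉ L.lattice) :
      AnalyticOnNhd ℂ (fun z ↦ L.weierstrassP (c + z)) Sᶜ := fun z hz ↦
    (L.analyticOnNhd_weierstrassP (c + z) (hc z hz)).fun_comp (by fun_prop)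
  have hEq : Set.EqOn (fun z ↦ L.weierstrassP (a + z)) (fun z ↦ L.weierstrassP (b + z)) Sᶜ := by
    refine (han a fun z hz h ↦ hz (Or.inl h)).eqOn_of_preconnected_of_frequently_eq
      (han b fun z hz h ↦ hz (Or.inr h))
      (hScount.isConnected_compl_of_one_lt_rank (by simp)).isPreconnected
      (z₀ := 0) (by simp [hS, ha, hb]) ?_
    have hfreq : ∃ᶠ s : ℝ in 𝓝[>] 0, L.weierstrassP (a + s) = L.weierstrassP (b + s) := by
      refine Eventually.frequently ?_
      filter_upwards [Ioc_mem_nhdsGT (half_pos hε)] with s hs using heq s ⟨hs.1.le, hs.2⟩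
    have ht : Tendsto (fun s : ℝ ↦ (s : ℂ)) (𝓝[>] 0) (𝓝[≠] 0) := by
      refine tendsto_nhdsWithin_iff.mpr ⟨?_, ?_⟩
      · have := Complex.continuous_ofReal.tendsto 0
        simpa using this.mono_left nhdsWithin_le_nhds
      · filter_upwards [self_mem_nhdsWithin] with s hs
        simpa using (ne_of_gt hs)
    exact ht.frequently hfreq
  -- At z = -a the left translate has a pole, while the right one is finite if a - b is not in the
  -- lattice.
  by_contra hab
  have htr : Tendsto (fun z ↦ a + z) (𝓝[≠] (-a)) (𝓝[≠] 0) := by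
    refine tendsto_nhdsWithin_iff.mpr ⟨?_, ?_⟩
    · have : Continuous fun z ↦ a + z := by fun_prop
      simpa using (this.tendsto (-a)).mono_left nhdsWithin_le_nhds
    · filter_upwards [self_mem_nhdsWithin] with z hz e
      exact hz (eq_neg_of_add_eq_zero_right e)
  have h1 : Tendsto (fun z ↦ L.weierstrassP (a + z)) (𝓝[≠] (-a)) (Bornology.cobounded ℂ) := by
    have h0 := L.tendsto_weierstrassP_cobounded (zero_mem _)
    exact h0.comp htr
  have hba : b + -a ∉ L.lattice := fun e ↦ hab (by simpa [sub_eq_add_neg, add_comm] using neg_mem e)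
  have h2 : Tendsto (fun z ↦ L.weierstrassP (b + z)) (𝓝[≠] (-a)) (𝓝 (L.weierstrassP (b + -a))) := by
    have hc : ContinuousAt (fun z ↦ L.weierstrassP (b + z)) (-a) :=
      ((L.analyticOnNhd_weierstrassP (b + -a) hba).fun_comp (f := fun z ↦ b + z)
        (by fun_prop)).continuousAt
    exact hc.tendsto.mono_left nhdsWithin_le_nhds
  have h3 : ∀ᶠ z in 𝓝[≠] (-a), z ∈ Sᶜ := by
    have e1 : ∀ᶠ z in 𝓝[≠] (-a), a + z ∉ L.lattice := by
      exact htr.eventually (L.eventually_notMem_lattice 0)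
    have e2 : ∀ᶠ z in 𝓝[≠] (-a), b + z ∉ L.lattice := by
      have : Continuous fun z ↦ b + z := by fun_prop
      exact nhdsWithin_le_nhds ((this.tendsto (-a)).eventually (L.isOpen_compl_lattice.mem_nhds hba))
    filter_upwards [e1, e2] with z h1 h2 h
    exact h.elim h1 h2
  exact h2.not_tendsto (Metric.disjoint_nhds_cobounded _) (h1.congr' (h3.mono hEq))

end PeriodPair

/-! ### The period lattice of the curve. -/

namespace GenusOne

open PeriodPair MeasureTheory

variable {L : PeriodPair} {l : ℂ × ℂ}

/-- The segment from v to v + ω maps to a closed path on the curve along which du has constant value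
ω. -/
lemma mem_periodLattice_of_forall_notMem (h₂ : L.g₂ = -4 * l.1) (h₃ : L.g₃ = -4 * l.2)
    {v ω : ℂ} (hω : ω ∈ L.lattice) (hv : ∀ t : ℝ, v + t * ω ∉ L.lattice) :
    ω ∈ periodLattice l := by
  have hu (t : ℝ) : HasDerivAt (fun s : ℝ ↦ v + (s : ℂ) * ω) ω t := by
    simpa using ((Complex.ofRealCLM.hasDerivAt (x := t)).mul_const ω).const_add v
  have hm : -L.g₂ / 4 = l.1 := by rw [h₂]; ring
  let c : CurveLoop l :=
    { x := fun t ↦ L.weierstrassP (v + t * ω)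
      y := fun t ↦ L.derivWeierstrassP (v + t * ω) / 2
      w := fun _ ↦ ω
      mem_curve := fun t _ ↦ by
        have := L.derivWeierstrassP_sq _ (hv t)
        rw [h₂, h₃] at this
        linear_combination this / 4
      continuousOn_w := continuousOn_const
      hasDeriv_x := fun t _ ↦ (L.hasDerivAt_weierstrassP_comp (hu t) (hv t)).hasDerivWithinAt
      hasDeriv_y := fun t _ ↦ by
        have := (L.hasDerivAt_derivWeierstrassP_comp (hu t) (hv t)).hasDerivWithinAt
          (s := Set.Icc 0 1)
        rwa [hm] at this
      x_closed := by simpa using (L.weierstrassP_add_coe v ⟨ω, hω⟩).symm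
      y_closed := by simpa using (L.derivWeierstrassP_add_coe v ⟨ω, hω⟩).symm }
  have hc : c.period = ω := by simp [CurveLoop.period, c]
  exact AddSubgroup.subset_closure ⟨c, hc⟩

/-- Lifting a closed path on the curve along `u ↦ (℘ u, ℘' u / 2)` shows that its period is
in the lattice. -/
lemma CurveLoop.period_mem_lattice (h₂ : L.g₂ = -4 * l.1) (h₃ : L.g₃ = -4 * l.2)
    (c : CurveLoop l) : c.period ∈ L.lattice := by
  have hm : -L.g₂ / 4 = l.1 := by rw [h₂]; ring
  obtain ⟨u₀, hu₀, hx₀, hy₀⟩ :=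
    L.exists_weierstrassP_eq_derivWeierstrassP_eq (x := c.x 0) (y := 2 * c.y 0) (by
      rw [h₂, h₃]
      linear_combination 4 * c.mem_curve 0 (by simp))
  -- Extending the integrand continuously to ℝ makes the lift `u` differentiable everywhere,
  -- endpoints included.
  set w : ℝ → ℂ := Set.IccExtend zero_le_one ((Set.Icc (0 : ℝ) 1).domRestrict c.w) with hw
  have hwc : Continuous w := (continuousOn_iff_continuous_domRestrict.mp c.continuousOn_w).Icc_extend'
  have hww : ∀ t ∈ Set.Icc (0 : ℝ) 1, w t = c.w t := fun t ht ↦ by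
    rw [hw, Set.IccExtend_of_mem _ _ ht]; rfl
  set u : ℝ → ℂ := fun t ↦ u₀ + ∫ s in (0 : ℝ)..t, w s with hu
  have hud (t : ℝ) : HasDerivAt u (w t) t :=
    (intervalIntegral.integral_hasDerivAt_right (hwc.intervalIntegrable _ _)
      (hwc.stronglyMeasurableAtFilter _ _) hwc.continuousAt).const_add u₀
  have huc : Continuous u := continuous_iff_continuousAt.mpr fun t ↦ (hud t).continuousAt
  have hxc : ContinuousOn c.x (Set.Icc 0 1) := fun t ht ↦ (c.hasDeriv_x t ht).continuousWithinAt
  have hyc : ContinuousOn c.y (Set.Icc 0 1) := fun t ht ↦ (c.hasDeriv_y t ht).continuousWithinAt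
  -- Continuity method: the set where the lift follows the path is closed, since `c.x` stays finite
  -- and keeps `u` off the poles, and is open to the right by `cubic_ode_unique`.
  set S : Set ℝ := {t | u t ∉ L.lattice ∧ L.weierstrassP (u t) = c.x t ∧
    L.derivWeierstrassP (u t) / 2 = c.y t} with hS
  have hclosed : IsClosed (S ∩ Set.Icc 0 1) := by
    refine isClosed_of_closure_subset fun t ht ↦ ?_
    have htI : t ∈ Set.Icc (0 : ℝ) 1 :=
      isClosed_Icc.closure_subset_iff.mpr Set.inter_subset_right ht
    have hne : (𝓝[S ∩ Set.Icc 0 1] t).NeBot := mem_closure_iff_nhdsWithin_neBot.mp ht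
    have hx : Tendsto c.x (𝓝[S ∩ Set.Icc 0 1] t) (𝓝 (c.x t)) :=
      (hxc t htI).mono_left (nhdsWithin_mono _ Set.inter_subset_right)
    have hy : Tendsto c.y (𝓝[S ∩ Set.Icc 0 1] t) (𝓝 (c.y t)) :=
      (hyc t htI).mono_left (nhdsWithin_mono _ Set.inter_subset_right)
    have hut : Tendsto u (𝓝[S ∩ Set.Icc 0 1] t) (𝓝 (u t)) :=
      huc.continuousAt.tendsto.mono_left nhdsWithin_le_nhds
    have hmem : ∀ᶠ s in 𝓝[S ∩ Set.Icc 0 1] t, s ∈ S := by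
      filter_upwards [self_mem_nhdsWithin] with s hs using hs.1
    have hnot : u t ∉ L.lattice := by
      intro hL
      have h1 : Tendsto u (𝓝[S ∩ Set.Icc 0 1] t) (𝓝[≠] (u t)) := by
        refine tendsto_nhdsWithin_iff.mpr ⟨hut, ?_⟩
        filter_upwards [hmem] with s hs e
        exact hs.1 (by rw [e]; exact hL)
      have h2 := (L.tendsto_weierstrassP_cobounded hL).comp h1
      refine hx.not_tendsto (Metric.disjoint_nhds_cobounded _) (h2.congr' ?_)
      filter_upwards [hmem] with s hs using hs.2.1
    have hx' := (L.hasDerivAt_weierstrassP hnot).continuousAt.tendsto.comp hut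
    have hy' := ((L.hasDerivAt_derivWeierstrassP hnot).continuousAt.tendsto.comp hut).div_const 2
    refine ⟨⟨hnot, tendsto_nhds_unique hx' (hx.congr' ?_),
      tendsto_nhds_unique hy' (hy.congr' ?_)⟩, htI⟩
    · filter_upwards [hmem] with s hs using hs.2.1.symm
    · filter_upwards [hmem] with s hs using hs.2.2.symm
  have hsub : Set.Icc (0 : ℝ) 1 ⊆ S := by
    refine hclosed.Icc_subset_of_forall_mem_nhdsWithin ?_ ?_
    · simp [hS, hu, hu₀, hx₀, hy₀]
    · rintro t ⟨⟨htL, htx, hty⟩, ht0, ht1⟩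
      have hev : ∀ᶠ s in 𝓝 t, u s ∉ L.lattice :=
        huc.continuousAt.eventually (L.isOpen_compl_lattice.mem_nhds htL)
      obtain ⟨ε, hε, hball⟩ := Metric.eventually_nhds_iff_ball.mp hev
      set b := min 1 (t + ε / 2) with hb
      have htb : t < b := lt_min ht1 (by linarith)
      have hI : Set.Icc t b ⊆ Set.Icc 0 1 :=
        Set.Icc_subset_Icc ht0 (min_le_left _ _)
      have hnot : ∀ s ∈ Set.Icc t b, u s ∉ L.lattice := by
        intro s hs
        refine hball s ?_
        have : s ≤ t + ε / 2 := hs.2.trans (min_le_right _ _)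
        rw [Real.ball_eq_Ioo]
        constructor <;> linarith [hs.1]
      filter_upwards [Ioc_mem_nhdsGT htb] with s hs
      have hs' : s ∈ Set.Icc t b := ⟨hs.1.le, hs.2⟩
      refine ⟨hnot s hs', ?_⟩
      refine cubic_ode_unique (m := l.1) (w := c.w) (x₁ := fun s ↦ L.weierstrassP (u s))
        (y₁ := fun s ↦ L.derivWeierstrassP (u s) / 2) (c.continuousOn_w.mono hI)
        (fun r hr ↦ ?_) (fun r hr ↦ ?_)
        (fun r hr ↦ (c.hasDeriv_x r (hI hr)).mono hI)
        (fun r hr ↦ (c.hasDeriv_y r (hI hr)).mono hI) htx hty hs'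
      · have := (L.hasDerivAt_weierstrassP_comp (hud r) (hnot r hr)).hasDerivWithinAt
          (s := Set.Icc t b)
        rwa [hww r (hI hr)] at this
      · have := (L.hasDerivAt_derivWeierstrassP_comp (hud r) (hnot r hr)).hasDerivWithinAt
          (s := Set.Icc t b)
        rwa [hww r (hI hr), hm] at this
  obtain ⟨h1, hx1, hy1⟩ := hsub (Set.right_mem_Icc.mpr zero_le_one)
  have hper : u 1 - u₀ = c.period := by
    rw [hu, CurveLoop.period, add_sub_cancel_left]
    refine intervalIntegral.integral_congr fun t ht ↦ hww t ?_
    rwa [Set.uIcc_of_le zero_le_one] at ht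
  rw [← hper]
  refine L.sub_mem_lattice_of_eq h1 hu₀ ?_ ?_
  · rw [hx1, hx₀, c.x_closed]
  · rw [hy₀, c.y_closed]
    linear_combination 2 * hy1

lemma mem_periodLattice_iff (h₂ : L.g₂ = -4 * l.1) (h₃ : L.g₃ = -4 * l.2) (z : ℂ) :
    z ∈ periodLattice l ↔ z ∈ L.lattice := by
  refine ⟨fun hz ↦ ?_, fun hz ↦ ?_⟩
  · have : periodLattice l ≤ L.lattice.toAddSubgroup := by
      refine (AddSubgroup.closure_le _).mpr ?_
      rintro _ ⟨c, rfl⟩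
      exact c.period_mem_lattice h₂ h₃
    exact this hz
  · have hind := LinearIndependent.pair_iff.mp L.indep
    -- The line through ω₂/2 in direction ω₁ misses the lattice, its ω₂-coordinate being 1/2;
    -- likewise with the roles exchanged.
    have hω₁ : L.ω₁ ∈ periodLattice l := by
      refine mem_periodLattice_of_forall_notMem h₂ h₃ (v := L.ω₂ / 2) L.ω₁_mem_lattice
        fun t ht ↦ ?_
      obtain ⟨m, n, e⟩ := mem_lattice.mp ht
      have := (hind (m - t) (n - 1 / 2) (by simp; linear_combination e)).2
      have h : ((2 * n : ℤ) : ℝ) = (1 : ℤ) := by push_cast; linarith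
      have := Int.cast_injective h
      omega
    have hω₂ : L.ω₂ ∈ periodLattice l := by
      refine mem_periodLattice_of_forall_notMem h₂ h₃ (v := L.ω₁ / 2) L.ω₂_mem_lattice
        fun t ht ↦ ?_
      obtain ⟨m, n, e⟩ := mem_lattice.mp ht
      have := (hind (m - 1 / 2) (n - t) (by simp; linear_combination e)).1
      have h : ((2 * m : ℤ) : ℝ) = (1 : ℤ) := by push_cast; linarith
      have := Int.cast_injective h
      omega
    obtain ⟨m, n, rfl⟩ := mem_lattice.mp hz
    simp only [← zsmul_eq_mul]
    exact add_mem (zsmul_mem hω₁ m) (zsmul_mem hω₂ n)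

end GenusOne

/-! ### The Weierstrass zeta and sigma functions. -/

namespace PeriodPair

variable (L : PeriodPair)

/-- The summands of the Weierstrass zeta function; the term at `l = 0` is `1 / z`. -/
noncomputable def zetaTerm (l z : ℂ) : ℂ := 1 / (z - l) + 1 / l + z / l ^ 2

/-- The Weierstrass zeta function of a lattice. -/
noncomputable def weierstrassZeta (z : ℂ) : ℂ := ∑' l : L.lattice, zetaTerm l z

/-- The factors of the Weierstrass sigma function; the factor at `l = 0` is `1`. -/
noncomputable def sigmaFactor (l z : ℂ) : ℂ :=
  (1 - z / l) * Complex.exp (z / l + z ^ 2 / (2 * l ^ 2))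

/-- For l ≠ 0 the term is z²/(l²(z - l)), of size O(|l|⁻³) on compact sets, which is summable in
rank 2. -/
lemma hasSumLocallyUniformly_weierstrassZeta :
    HasSumLocallyUniformly (fun (l : L.lattice) (z : ℂ) ↦ zetaTerm l z) L.weierstrassZeta := by
  refine L.hasSumLocallyUniformly_aux (u := fun r l ↦ 2 * r ^ 2 * ‖l‖ ^ (-3 : ℝ)) _
    (fun r hr ↦ (ZLattice.summable_norm_rpow _ _ (by simp; norm_num)).mul_left _) fun r hr ↦ ?_
  filter_upwards [eventually_ge_atTop (2 * r)] with R hR x hx l hl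
  have hl0 : 0 < ‖(l : ℂ)‖ := by rw [hl]; linarith
  have hl0' : (l : ℂ) ≠ 0 := norm_pos_iff.mp hl0
  have hxl : ‖(l : ℂ)‖ / 2 ≤ ‖x - l‖ := by
    have := norm_sub_norm_le (l : ℂ) x
    rw [norm_sub_rev]
    linarith
  have hxl0 : x - l ≠ 0 := norm_pos_iff.mp (by linarith)
  have e : zetaTerm l x = x ^ 2 / (l ^ 2 * (x - l)) := by
    simp only [zetaTerm]
    field_simp
    ring
  rw [e, norm_div, norm_mul, norm_pow, norm_pow, show ‖l‖ = ‖(l : ℂ)‖ from rfl,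
    show (-3 : ℝ) = ((-3 : ℤ) : ℝ) by norm_num, Real.rpow_intCast]
  calc ‖x‖ ^ 2 / (‖(l : ℂ)‖ ^ 2 * ‖x - l‖) ≤ r ^ 2 / (‖(l : ℂ)‖ ^ 2 * (‖(l : ℂ)‖ / 2)) := by
        gcongr
    _ = 2 * r ^ 2 * ‖(l : ℂ)‖ ^ (-3 : ℤ) := by
        rw [zpow_neg]
        norm_cast
        field_simp

lemma hasDerivAt_zetaTerm {l z : ℂ} (h : z ≠ l) :
    HasDerivAt (zetaTerm l) (-(1 / (z - l) ^ 2 - 1 / l ^ 2)) z := by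
  have h' : z - l ≠ 0 := sub_ne_zero.mpr h
  have h1 := ((hasDerivAt_id z).sub_const l).fun_inv h'
  have h2 := ((h1.add_const (1 / l)).add ((hasDerivAt_id z).div_const (l ^ 2)))
  convert! h2 using 1
  · funext y
    simp [zetaTerm]
  · simp only [id]
    ring

lemma hasDerivAt_weierstrassZeta {z : ℂ} (hz : z ∉ L.lattice) :
    HasDerivAt L.weierstrassZeta (-L.weierstrassP z) z := by
  have hne {y : ℂ} (hy : y ∉ L.lattice) (l : L.lattice) : y ≠ l := fun e ↦ hy (e ▸ l.2)
  have hlu := L.hasSumLocallyUniformly_weierstrassZeta.hasSumLocallyUniformlyOn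
    (s := (L.lattice : Set ℂ)ᶜ)
  have hdf : ∀ s : Finset L.lattice, DifferentiableOn ℂ (fun y ↦ ∑ l ∈ s, zetaTerm l y)
      ((L.lattice : Set ℂ)ᶜ) := fun s y hy ↦
    (DifferentiableAt.fun_sum fun l _ ↦
      (hasDerivAt_zetaTerm (hne hy l)).differentiableAt).differentiableWithinAt
  have hd : DifferentiableOn ℂ L.weierstrassZeta ((L.lattice : Set ℂ)ᶜ) :=
    hlu.differentiableOn (.of_forall hdf) L.isOpen_compl_lattice
  have h1 := (TendstoLocallyUniformlyOn.deriv (L.hasSumLocallyUniformly_weierstrassZeta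
    |>.tendstoLocallyUniformlyOn (s := (L.lattice : Set ℂ)ᶜ)) (.of_forall hdf)
    L.isOpen_compl_lattice).tendsto_at (a := z) hz
  have h2 : Tendsto (fun s : Finset L.lattice ↦ deriv (fun y ↦ ∑ l ∈ s, zetaTerm l y) z) atTop
      (𝓝 (-L.weierstrassP z)) := by
    refine Tendsto.congr (fun s ↦ ?_) (L.hasSum_weierstrassP z).neg
    exact (HasDerivAt.fun_sum fun l _ ↦ hasDerivAt_zetaTerm (hne hz l)).deriv.symm
  rw [← tendsto_nhds_unique h1 h2]
  exact (hd.differentiableAt (L.isOpen_compl_lattice.mem_nhds hz)).hasDerivAt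

/-- The exponential is chosen so that the derivative is -y² exp(y + y²/2); the mean value inequality
then gives the cubic bound. -/
lemma _root_.Complex.norm_one_sub_mul_exp_sub_one_le {z : ℂ} (hz : ‖z‖ ≤ 1) :
    ‖(1 - z) * Complex.exp (z + z ^ 2 / 2) - 1‖ ≤ Real.exp 2 * ‖z‖ ^ 3 := by
  have hd (y : ℂ) : HasDerivAt (fun y ↦ (1 - y) * Complex.exp (y + y ^ 2 / 2))
      (-y ^ 2 * Complex.exp (y + y ^ 2 / 2)) y := by
    have h1 := (hasDerivAt_id y).const_sub 1
    have h2 := ((hasDerivAt_id y).add (((hasDerivAt_id y).fun_pow 2).div_const 2)).cexp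
    convert! h1.mul h2 using 1
    simp
    ring
  have h := (convex_closedBall (0 : ℂ) ‖z‖).norm_image_sub_le_of_norm_hasDerivWithin_le
    (f := fun y ↦ (1 - y) * Complex.exp (y + y ^ 2 / 2)) (C := Real.exp 2 * ‖z‖ ^ 2)
    (fun y _ ↦ (hd y).hasDerivWithinAt) (fun y hy ↦ ?_) (x := 0) (y := z) (by simp) (by simp)
  · simpa [pow_succ, mul_assoc] using h
  · have hy' : ‖y‖ ≤ ‖z‖ := by simpa using hy
    rw [norm_mul, norm_neg, norm_pow, mul_comm]
    gcongr
    refine (Complex.norm_exp_le_exp_norm _).trans (Real.exp_le_exp.mpr ?_)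
    calc ‖y + y ^ 2 / 2‖ ≤ ‖y‖ + ‖y‖ ^ 2 / 2 := by
          refine (norm_add_le _ _).trans ?_
          simp
      _ ≤ 2 := by nlinarith [norm_nonneg y]

lemma norm_sigmaFactor_sub_one_le {l z : ℂ} {r : ℝ} (hz : ‖z‖ ≤ r) (hr : r < ‖l‖) :
    ‖sigmaFactor l z - 1‖ ≤ Real.exp 2 * r ^ 3 * ‖l‖ ^ (-3 : ℝ) := by
  have hr0 : 0 ≤ r := (norm_nonneg z).trans hz
  have hl : 0 < ‖l‖ := hr0.trans_lt hr
  have h1 : ‖z / l‖ ≤ 1 := by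
    rw [norm_div, div_le_one hl]
    exact hz.trans hr.le
  have h := Complex.norm_one_sub_mul_exp_sub_one_le h1
  have e : sigmaFactor l z = (1 - z / l) * Complex.exp (z / l + (z / l) ^ 2 / 2) := by
    rw [sigmaFactor, div_pow, div_div, mul_comm (l ^ 2)]
  rw [e]
  refine h.trans ?_
  rw [norm_div, div_pow, show (-3 : ℝ) = ((-3 : ℤ) : ℝ) by norm_num, Real.rpow_intCast,
    zpow_neg, mul_assoc, div_eq_mul_inv]
  norm_cast
  gcongr

lemma summable_sigmaBound (r : ℝ) :
    Summable fun l : L.lattice ↦ Real.exp 2 * r ^ 3 * ‖(l : ℂ)‖ ^ (-3 : ℝ) :=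
  (ZLattice.summable_norm_rpow L.lattice (-3) (by simp; norm_num)).mul_left _

lemma eventually_lt_norm_lattice (r : ℝ) : ∀ᶠ l : L.lattice in cofinite, r < ‖(l : ℂ)‖ := by
  refine (isCompact_iff_finite.mp (isCompact_closedBall (0 : L.lattice) r)).subset fun l hl ↦ ?_
  simpa using hl

lemma continuous_sigmaFactor (l : ℂ) : Continuous (sigmaFactor l) := by
  unfold sigmaFactor
  fun_prop

lemma multipliableLocallyUniformlyOn_sigmaFactor :
    MultipliableLocallyUniformlyOn (fun l : L.lattice ↦ sigmaFactor l) Set.univ := by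
  have h := hasProdLocallyUniformlyOn_of_forall_compact
    (f := fun (l : L.lattice) z ↦ 1 + (sigmaFactor l z - 1)) (s := Set.univ)
    (g := fun z ↦ ∏' l : L.lattice, (1 + (sigmaFactor l z - 1))) isOpen_univ fun K _ hK ↦ ?_
  · exact ⟨fun z ↦ ∏' l : L.lattice, (1 + (sigmaFactor l z - 1)), by simpa using h⟩
  · obtain ⟨r, hr⟩ := hK.isBounded.exists_norm_le
    refine Summable.hasProdUniformlyOn_one_add hK (L.summable_sigmaBound r) ?_
      fun l ↦ ((continuous_sigmaFactor l).sub continuous_const).continuousOn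
    filter_upwards [L.eventually_lt_norm_lattice r] with l hl x hx
    exact norm_sigmaFactor_sub_one_le (hr x hx) hl

lemma sigmaFactor_ne_zero {z : ℂ} (hz : z ∉ L.lattice) (l : L.lattice) : sigmaFactor l z ≠ 0 := by
  refine mul_ne_zero ?_ (Complex.exp_ne_zero _)
  by_cases hl : (l : ℂ) = 0
  · simp [hl]
  · rw [sub_ne_zero, ne_comm, Ne, div_eq_one_iff_eq hl]
    exact fun e ↦ hz (e ▸ l.2)

lemma tprod_sigmaFactor_ne_zero {z : ℂ} (hz : z ∉ L.lattice) :
    ∏' l : L.lattice, sigmaFactor l z ≠ 0 := by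
  have := tprod_one_add_ne_zero_of_summable (f := fun l : L.lattice ↦ sigmaFactor l z - 1)
    (fun l ↦ by simpa using L.sigmaFactor_ne_zero hz l) ?_
  · simpa using this
  · refine Summable.of_norm_bounded_eventually (L.summable_sigmaBound ‖z‖) ?_
    filter_upwards [L.eventually_lt_norm_lattice ‖z‖] with l hl
    simpa using norm_sigmaFactor_sub_one_le le_rfl hl

lemma hasDerivAt_sigmaFactor {l : ℂ} (hl : l ≠ 0) (z : ℂ) :
    HasDerivAt (sigmaFactor l) (-(z ^ 2 / l ^ 3) * Complex.exp (z / l + z ^ 2 / (2 * l ^ 2))) z := by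
  have h1 := ((hasDerivAt_id z).div_const l).const_sub 1
  have h2 := (((hasDerivAt_id z).div_const l).add
    (((hasDerivAt_id z).fun_pow 2).div_const (2 * l ^ 2))).cexp
  convert! h1.mul h2 using 1
  simp
  field_simp
  ring

lemma differentiable_sigmaFactor (l : ℂ) : Differentiable ℂ (sigmaFactor l) := by
  unfold sigmaFactor
  fun_prop

/-- At l = 0 the factor is 1, whereas `zetaTerm` is 1/z; that missing 1/z comes from the factor u in
front of the product for σ. -/
lemma logDeriv_sigmaFactor {z : ℂ} (hz : z ∉ L.lattice) (l : L.lattice) :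
    logDeriv (sigmaFactor l) z = zetaTerm l z - if l = 0 then 1 / z else 0 := by
  split_ifs with h
  · subst h
    have : sigmaFactor 0 = fun _ ↦ 1 := by funext y; simp [sigmaFactor]
    simp [this, zetaTerm]
  · have hl : (l : ℂ) ≠ 0 := by simpa using h
    have hzl : z - l ≠ 0 := sub_ne_zero.mpr fun e ↦ hz (e ▸ l.2)
    have hlz : (l : ℂ) - z ≠ 0 := fun e ↦ hzl (by linear_combination -e)
    have h1 : 1 - z / l ≠ 0 := by
      rw [one_sub_div hl]
      exact div_ne_zero hlz hl
    rw [logDeriv_apply, (hasDerivAt_sigmaFactor hl z).deriv, sigmaFactor,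
      mul_div_mul_right _ _ (Complex.exp_ne_zero _), zetaTerm, one_sub_div hl]
    field_simp
    ring

/-- The logarithmic derivative of the sigma function is the zeta function. -/
lemma logDeriv_mul_tprod_sigmaFactor {z : ℂ} (hz : z ∉ L.lattice) :
    logDeriv (fun u ↦ u * ∏' l : L.lattice, sigmaFactor l u) z = L.weierstrassZeta z := by
  have hz0 : z ≠ 0 := fun e ↦ hz (e ▸ zero_mem _)
  have hs : HasSum (fun l : L.lattice ↦ logDeriv (sigmaFactor l) z)
      (L.weierstrassZeta z - 1 / z) := by
    simp_rw [L.logDeriv_sigmaFactor hz]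
    exact L.hasSumLocallyUniformly_weierstrassZeta.hasSum.sub (hasSum_ite_eq 0 (1 / z))
  have hm := L.multipliableLocallyUniformlyOn_sigmaFactor
  have hdiff : DifferentiableOn ℂ (fun u ↦ ∏' l : L.lattice, sigmaFactor l u) Set.univ :=
    hm.hasProdLocallyUniformlyOn.differentiableOn
      (.of_forall fun s ↦ (Differentiable.fun_finsetProd (u := s)
        (f := fun l : L.lattice ↦ sigmaFactor l) fun l _ ↦ differentiable_sigmaFactor l).differentiableOn)
      isOpen_univ
  have hp := logDeriv_tprod_eq_tsum isOpen_univ (Set.mem_univ z)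
    (f := fun l : L.lattice ↦ sigmaFactor l) (L.sigmaFactor_ne_zero hz)
    (fun l ↦ (differentiable_sigmaFactor l).differentiableOn) hs.summable hm
    (L.tprod_sigmaFactor_ne_zero hz)
  rw [hs.tsum_eq] at hp
  have := logDeriv_mul (f := fun u : ℂ ↦ u) (g := fun u ↦ ∏' l : L.lattice, sigmaFactor l u) z hz0
    (L.tprod_sigmaFactor_ne_zero hz) differentiableAt_id
    (hdiff.differentiableAt Filter.univ_mem)
  rw [this, hp]
  simp [logDeriv_apply]

end PeriodPair

/-! ### The ring generated by the ℘_i. -/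

namespace GenusOne

open PeriodPair MvPolynomial

lemma sigma_eq_mul_tprod {L : PeriodPair} {l : ℂ × ℂ}
    (h : ∀ z, z ∈ periodLattice l ↔ z ∈ L.lattice) :
    sigma l = fun u ↦ u * ∏' ω : L.lattice, sigmaFactor ω u := by
  funext u
  have h1 : ∏' ω : {ω : periodLattice l // ω ≠ 0}, sigmaFactor (ω.1 : ℂ) u =
      ∏' ω : periodLattice l, sigmaFactor (ω : ℂ) u := by
    refine tprod_subtype_eq_of_mulSupport_subset (s := {ω : periodLattice l | ω ≠ 0})
      (f := fun ω : periodLattice l ↦ sigmaFactor (ω : ℂ) u) fun ω hω ↦ ?_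
    rintro rfl
    exact hω (by simp [sigmaFactor])
  have h2 := (Equiv.subtypeEquivRight h).tprod_eq (fun ω : L.lattice ↦ sigmaFactor (ω : ℂ) u)
  exact congrArg (u * ·) (h1.trans h2)

lemma wp_add_two {L : PeriodPair} {l : ℂ × ℂ}
    (h : ∀ z, z ∈ periodLattice l ↔ z ∈ L.lattice) (n : ℕ) {u : ℂ} (hu : u ∉ L.lattice) :
    wp (n + 2) l u = iteratedDeriv n L.weierstrassP u := by
  have hmem := L.isOpen_compl_lattice.mem_nhds hu
  have h1 : zeta l =ᶠ[𝓝 u] L.weierstrassZeta := by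
    filter_upwards [hmem] with z hz
    rw [zeta, sigma_eq_mul_tprod h, L.logDeriv_mul_tprod_sigmaFactor hz]
  have h2 : deriv L.weierstrassZeta =ᶠ[𝓝 u] -L.weierstrassP := by
    filter_upwards [hmem] with z hz using (L.hasDerivAt_weierstrassZeta hz).deriv
  rw [wp, show n + 2 - 1 = n + 1 by omega, h1.iteratedDeriv_eq, iteratedDeriv_succ',
    h2.iteratedDeriv_eq, iteratedDeriv_neg, neg_neg]

/-- The derivation of `ℂ[x₂, x₃, x₄]` which corresponds to `∂ / ∂u`. -/
noncomputable def wpDerivation : Derivation ℂ (MvPolynomial (Fin 3) ℂ) (MvPolynomial (Fin 3) ℂ) :=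
  mkDerivation ℂ ![X 1, X 2, 12 * X 0 * X 1]

/-- The point `(℘, ℘', ℘'')`. -/
noncomputable def wpPoint (L : PeriodPair) (z : ℂ) : Fin 3 → ℂ :=
  ![L.weierstrassP z, L.derivWeierstrassP z, 6 * L.weierstrassP z ^ 2 - L.g₂ / 2]

/-- By the Leibniz rule only the generators matter; for the third, the constant g₂ drops out of (6℘²
- g₂/2)' = 12℘℘'. -/
lemma hasDerivAt_aeval_wpPoint {L : PeriodPair} {z : ℂ} (hz : z ∉ L.lattice)
    (P : MvPolynomial (Fin 3) ℂ) :
    HasDerivAt (fun y ↦ aeval (wpPoint L y) P) (aeval (wpPoint L z) (wpDerivation P)) z := by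
  induction P using MvPolynomial.induction_on with
  | C a => simpa [wpDerivation] using hasDerivAt_const z a
  | add p q hp hq => simpa using hp.fun_add hq
  | mul_X p i hp =>
    have hi : HasDerivAt (fun y ↦ wpPoint L y i)
        (aeval (wpPoint L z) (wpDerivation (X i))) z := by
      have h1 := L.hasDerivAt_weierstrassP hz
      have h2 := L.hasDerivAt_derivWeierstrassP hz
      fin_cases i
      · simpa [wpPoint, wpDerivation] using h1
      · simpa [wpPoint, wpDerivation] using h2
      · convert! ((h1.fun_pow 2).const_mul 6).sub_const (L.g₂ / 2) using 1
        simp [wpPoint, wpDerivation]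
        ring
    convert! hp.fun_mul hi using 1
    · simp
    · simp
      ring

lemma iteratedDeriv_weierstrassP_eq_aeval (n : ℕ) {L : PeriodPair} {z : ℂ} (hz : z ∉ L.lattice) :
    iteratedDeriv n L.weierstrassP z = aeval (wpPoint L z) (wpDerivation^[n] (X 0)) := by
  induction n generalizing z with
  | zero => simp [wpPoint]
  | succ n ih =>
    rw [iteratedDeriv_succ, Function.iterate_succ_apply']
    refine (hasDerivAt_aeval_wpPoint hz _).congr_of_eventuallyEq ?_ |>.deriv
    filter_upwards [L.isOpen_compl_lattice.mem_nhds hz] with y hy using ih hy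

/-- Uniformization of the curve `V_λ`. -/
lemma exists_periodPair {l : ℂ × ℂ} (hl : l ∈ baseSpace) :
    ∃ L : PeriodPair, L.g₂ = -4 * l.1 ∧ L.g₃ = -4 * l.2 ∧
      ∀ z, z ∈ periodLattice l ↔ z ∈ L.lattice := by
  obtain ⟨L, h₂, h₃⟩ := PeriodPair.exists_g₂_eq_g₃_eq (a := -4 * l.1) (b := -4 * l.2) fun e ↦
    hl (by linear_combination -e / 16)
  exact ⟨L, h₂, h₃, mem_periodLattice_iff h₂ h₃⟩

lemma wpFun_add_two (n : ℕ) (q : regularDomain) :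
    wpFun (n + 2) q = aeval ![wpFun 2 q, wpFun 3 q, wpFun 4 q] (wpDerivation^[n] (X 0)) := by
  obtain ⟨L, -, -, hL⟩ := exists_periodPair q.2.1
  have hu : q.1.2 ∉ L.lattice := fun hu ↦ q.2.2 ((hL _).mpr hu)
  have key (n : ℕ) : wpFun (n + 2) q =
      aeval (wpPoint L q.1.2) (wpDerivation^[n] (X 0)) := by
    rw [wpFun, wp_add_two hL n hu, iteratedDeriv_weierstrassP_eq_aeval n hu]
  rw [key n]
  congr 2
  funext i
  fin_cases i
  · simpa [wpPoint] using (key 0).symm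
  · simpa [wpPoint, wpDerivation] using (key 1).symm
  · simpa [wpPoint, wpDerivation] using (key 2).symm

lemma wp_values {L : PeriodPair} {l : ℂ × ℂ} (hL : ∀ z, z ∈ periodLattice l ↔ z ∈ L.lattice)
    {u : ℂ} (hu : u ∉ L.lattice) :
    wp 2 l u = L.weierstrassP u ∧ wp 3 l u = L.derivWeierstrassP u ∧
      wp 4 l u = 6 * L.weierstrassP u ^ 2 - L.g₂ / 2 := by
  refine ⟨?_, ?_, ?_⟩
  · simpa using wp_add_two hL 0 hu
  · simpa [iteratedDeriv_one] using wp_add_two hL 1 hu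
  · rw [wp_add_two hL 2 hu, iteratedDeriv_succ, iteratedDeriv_one, L.deriv_weierstrassP,
      L.deriv_derivWeierstrassP hu]

/-- `(℘, ℘', ℘'')` takes every value at which the discriminant is nonzero. -/
lemma exists_wpFun_eq {a b c : ℂ}
    (h : (c / 2 - 3 * a ^ 2, (b / 2) ^ 2 + 2 * a ^ 3 - c * a / 2) ∈ baseSpace) :
    ∃ q : regularDomain, wpFun 2 q = a ∧ wpFun 3 q = b ∧ wpFun 4 q = c := by
  -- λ is read off from (a, b, c) by the formulas of part 2. Then (a, b/2) lies on the curve, and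
  -- ℘'' = c is automatic once ℘ = a.
  obtain ⟨L, h₂, h₃, hL⟩ := exists_periodPair h
  obtain ⟨u, hu, hx, hy⟩ := L.exists_weierstrassP_eq_derivWeierstrassP_eq (x := a) (y := b) (by
    rw [h₂, h₃]
    ring)
  obtain ⟨e2, e3, e4⟩ := wp_values hL hu
  refine ⟨⟨(_, u), h, fun hu' ↦ hu ((hL _).mp hu')⟩, e2.trans hx, e3.trans hy, e4.trans ?_⟩
  rw [hx, h₂]
  ring

/-- The evaluation of polynomials in three variables at `(℘, ℘', ℘'')`. -/
noncomputable def evalWp : MvPolynomial (Fin 3) ℂ →ₐ[ℂ] (regularDomain → ℂ) :=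
  aeval ![wpFun 2, wpFun 3, wpFun 4]

lemma evalWp_apply (P : MvPolynomial (Fin 3) ℂ) (q : regularDomain) :
    evalWp P q = aeval ![wpFun 2 q, wpFun 3 q, wpFun 4 q] P := by
  have := comp_aeval_apply (R := ℂ) (f := ![wpFun 2, wpFun 3, wpFun 4])
    (Pi.evalAlgHom ℂ (fun _ : regularDomain ↦ ℂ) q) P
  refine this.trans ?_
  congr 2
  funext i
  fin_cases i <;> rfl

/-- A polynomial `P` in the kernel vanishes wherever the discriminant `D` does not, so `P * D`
vanishes on all of ℂ³. -/
lemma evalWp_injective : Function.Injective evalWp := by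
  rw [injective_iff_map_eq_zero]
  intro P hP
  let l₄ : MvPolynomial (Fin 3) ℂ := C (1 / 2) * X 2 - 3 * X 0 ^ 2
  let l₆ : MvPolynomial (Fin 3) ℂ := C (1 / 4) * X 1 ^ 2 + 2 * X 0 ^ 3 - C (1 / 2) * X 2 * X 0
  let D := 4 * l₄ ^ 3 + 27 * l₆ ^ 2
  have hD : D ≠ 0 := by
    intro e
    -- At (0, 2, 0), λ₄ = 0 and λ₆ = 1, so `D` takes the value 27.
    have := congrArg (eval ![0, 2, 0]) e
    norm_num [D, l₄, l₆, show (![0, 2, 0] : Fin 3 → ℂ) 2 = 0 from rfl] at this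
  have hPD : P * D = 0 := by
    refine MvPolynomial.funext fun v ↦ ?_
    rw [map_mul, map_zero]
    by_cases hv : eval v D = 0
    · rw [hv, mul_zero]
    obtain ⟨q, h2, h3, h4⟩ := exists_wpFun_eq (a := v 0) (b := v 1) (c := v 2) (by
      intro e
      apply hv
      simp only [D, l₄, l₆, map_add, map_mul, map_pow, map_sub, eval_C, eval_X, map_ofNat]
      linear_combination e)
    have hq := congrFun hP q
    rw [evalWp_apply, h2, h3, h4, show ![v 0, v 1, v 2] = v from List.ofFn_inj.mp rfl] at hq
    rw [aeval_eq_eval] at hq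
    rw [show eval v P = 0 from hq, zero_mul]
  exact (mul_eq_zero.mp hPD).resolve_right hD

lemma range_evalWp : evalWp.range = ringP := by
  refine le_antisymm ?_ (Algebra.adjoin_le ?_)
  · rw [evalWp, ← Algebra.adjoin_range_eq_range_aeval]
    refine Algebra.adjoin_mono ?_
    rintro _ ⟨i, rfl⟩
    fin_cases i
    exacts [⟨2, by norm_num, rfl⟩, ⟨3, by norm_num, rfl⟩, ⟨4, by norm_num, rfl⟩]
  · rintro _ ⟨i, hi, rfl⟩
    obtain ⟨n, rfl⟩ := Nat.exists_eq_add_of_le' hi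
    exact ⟨wpDerivation^[n] (X 0), funext fun q ↦ by
      rw [wpFun_add_two]
      exact evalWp_apply _ q⟩

end GenusOne

end

theorem mainTheorem7 :
    (∃ e : MvPolynomial (Fin 3) ℂ ≃ₐ[ℂ] GenusOne.ringP,
      (e (MvPolynomial.X 0) : GenusOne.regularDomain → ℂ) = GenusOne.wpFun 2 ∧
      (e (MvPolynomial.X 1) : GenusOne.regularDomain → ℂ) = GenusOne.wpFun 3 ∧
      (e (MvPolynomial.X 2) : GenusOne.regularDomain → ℂ) = GenusOne.wpFun 4) ∧
    (∀ (l : GenusOne.baseSpace) (u : ℂ), u ∉ GenusOne.periodLattice l →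
      GenusOne.proj (GenusOne.toUniversal l u) =
        (1 / 2 * GenusOne.wp 4 l u - 3 * GenusOne.wp 2 l u ^ 2,
          (GenusOne.wp 3 l u / 2) ^ 2 + 2 * GenusOne.wp 2 l u ^ 3
            - 1 / 2 * GenusOne.wp 4 l u * GenusOne.wp 2 l u)) := by
  refine ⟨⟨(AlgEquiv.ofInjective GenusOne.evalWp GenusOne.evalWp_injective).trans
    (Subalgebra.equivOfEq _ _ GenusOne.range_evalWp), ?_, ?_, ?_⟩, fun l u hu ↦ ?_⟩
  · exact MvPolynomial.aeval_X ![GenusOne.wpFun 2, GenusOne.wpFun 3, GenusOne.wpFun 4] 0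
  · exact MvPolynomial.aeval_X ![GenusOne.wpFun 2, GenusOne.wpFun 3, GenusOne.wpFun 4] 1
  · exact MvPolynomial.aeval_X ![GenusOne.wpFun 2, GenusOne.wpFun 3, GenusOne.wpFun 4] 2
  · obtain ⟨L, h₂, h₃, hL⟩ := GenusOne.exists_periodPair l.2
    have hu' : u ∉ L.lattice := fun h ↦ hu ((hL u).mpr h)
    obtain ⟨e2, e3, e4⟩ := GenusOne.wp_values hL hu'
    have := L.derivWeierstrassP_sq u hu'
    rw [h₂, h₃] at this
    rw [e2, e3, e4, h₂]
    refine Prod.ext ?_ ?_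
    · change (l : ℂ × ℂ).1 = _
      ring
    · change (l : ℂ × ℂ).2 = _
      linear_combination -this / 4
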